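/- Let $M$ be a smooth manifold. A bivector field $\Lambda$ is identified with the $C^\infty(M)$-linear map $\Lambda:\Omega^1(M)\to\chi(M)$ given by $\langle\beta,\Lambda\alpha\rangle=\Lambda(\alpha,\beta)$. A pair $(\Lambda,E)$ of a bivector field and a vector field is a Jacobi structure if $[E,\Lambda]=0$ and $[\Lambda,\Lambda]=2E\wedge\Lambda$, where $[\ ,\ ]$ is the Schouten–Nijenhuis bracket, so that $[E,\Lambda]=L_E\Lambda$, i.e. $[E,\Lambda]\alpha=[E,\Lambda\alpha]-\Lambda L_E\alpha$, and with the sign convention $[\Lambda,\Lambda](df,dg,dh)=2\sum_{\mathrm{cyc}}\Lambda\big(d(\Lambda(df,dg)),dh\big)$; equivalently, $\{f,g\}=\Lambda(df,dg)+\langle f\,dg-g\,df,E\rangle$ satisfies the Jacobi identity. For a $(1,1)$-tensor field $J$ with transpose ${}^tJ$, let $$N_J(X,Y)=[JX,JY]-J[JX,Y]-J[X,JY]+J^2[X,Y];$$ $J$ is a Nijenhuis tensor if $N_J=0$. For a bivector field $\Lambda$ put $\{\alpha,\beta\}_\Lambda=L_{\Lambda\alpha}\beta-L_{\Lambda\beta}\alpha-d(\Lambda(\alpha,\beta))$,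 and if $J\circ\Lambda=\Lambda\circ{}^tJ$ let $J\Lambda$ be the bivector field given by $J\circ\Lambda$ and $$C(\Lambda,J)(\alpha,\beta)=\{\alpha,\beta\}_{J\Lambda}-\big(\{{}^tJ\alpha,\beta\}_\Lambda+\{\alpha,{}^tJ\beta\}_\Lambda-{}^tJ\{\alpha,\beta\}_\Lambda\big).$$ **Theorem.** Let $(\Lambda,E)$ be a Jacobi structure on $M$ and let $J$ be a $(1,1)$-tensor field such that $J\circ\Lambda=\Lambda\circ{}^tJ$, $N_J(\Lambda\alpha,\Lambda\beta)=0$ and $N_J(\Lambda\alpha,E)=0$ for all $\alpha,\beta\in\Omega^1(M)$. Then $(J\Lambda,JE)$ is a Jacobi structure on $M$ if and only if for all $\alpha,\beta,\gamma\in\Omega^1(M)$: (a) $J\big([JE,\Lambda]\alpha+[E,J\Lambda]\alpha\big)=0$; (b) $\big\langle{}^tJ\gamma,\ \Lambda\big(C(\Lambda,J)(\alpha,\beta)\big)-\Lambda(\alpha,\beta)\,JE+\Lambda(\alpha,{}^tJ\beta)\,E\big\rangle=0$. In particular, $(J\Lambda,JE)$ is a Jacobi structure whenever $J$ is a Nijenhuis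 tensor compatible with the Jacobi structure $(\Lambda,E)$. Here compatible means: $N_J(\Lambda\alpha,\Lambda\beta)=0$ and $N_J(\Lambda\alpha,J^kE)=0$ for all $\alpha,\beta$ and all $k\in\mathbb N$; $J\circ\Lambda=\Lambda\circ{}^tJ$; condition (b) holds for all $\alpha,\beta,\gamma$; and $[J^kE,\Lambda]+[E,J^k\Lambda]=0$ for every integer $k\ge1$. -/

import Mathlib

open scoped Manifold ContDiff

set_option linter.unusedSectionVars false

noncomputable section

namespace JacobiNijenhuis

/-! Tensor calculus on a smooth manifold `M` without boundary, modelled on the finite-dimensional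
real vector space `V`. Vector fields are smooth sections of the tangent bundle; all other tensor
fields are given by the `C^∞(M)`-multilinear maps which they induce on vector fields and 1-forms. -/

variable (V : Type*) [NormedAddCommGroup V] [NormedSpace ℝ V] [FiniteDimensional ℝ V]
  (M : Type*) [TopologicalSpace M] [ChartedSpace V M] [IsManifold 𝓘(ℝ, V) ∞ M]

/-- The ring `C^∞(M, ℝ)` of smooth functions. -/
abbrev Fn : Type _ := C^∞⟮𝓘(ℝ, V), M; ℝ⟯

/-- The space `χ(M)` of smooth vector fields. -/
abbrev VF : Type _ := Cₛ^∞⟮𝓘(ℝ, V); V, (TangentSpace 𝓘(ℝ, V) : M → Type _)⟯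

variable {V M}

/-- The product `f X` of a smooth function and a smooth vector field, `(f X)(x) = f(x) X(x)`. -/
instance : SMul (Fn V M) (VF V M) :=
  ⟨fun f X => ⟨fun x => f x • X x, f.contMDiff.smul_section X.contMDiff⟩⟩

theorem smul_apply (f : Fn V M) (X : VF V M) (x : M) : (f • X) x = f x • X x := rfl

instance : Module (Fn V M) (VF V M) where
  one_smul X := by ext x; exact one_smul ℝ (X x)
  mul_smul f g X := by ext x; exact mul_smul (f x) (g x) (X x)
  smul_zero f := by ext x; exact smul_zero (f x)
  smul_add f X Y := by ext x; exact smul_add (f x) (X x) (Y x)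
  add_smul f g X := by ext x; exact add_smul (f x) (g x) (X x)
  zero_smul X := by ext x; exact zero_smul ℝ (X x)

/-- The derivative `X(f) = df(X)` of a smooth function `f` along a vector field `X`. -/
def act (X : VF V M) (f : Fn V M) : Fn V M :=
  ⟨fun x => d% f x (X x), by
    have h1 : ContMDiff 𝓘(ℝ, V) 𝓘(ℝ, ℝ).tangent ∞
        (fun x => tangentMap 𝓘(ℝ, V) 𝓘(ℝ, ℝ) f (⟨x, X x⟩ : TangentBundle 𝓘(ℝ, V) M)) :=
      (f.contMDiff.contMDiff_tangentMap (m := ∞) (by simp)).comp X.contMDiff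
    intro x
    have h2 := (Bundle.contMDiffAt_totalSpace.1 (h1 x)).2
    simpa [tangentMap, mvfderiv] using! h2⟩

theorem act_add_fn (X : VF V M) (f g : Fn V M) : act X (f + g) = act X f + act X g := by
  ext x
  have := mvfderiv_add (f.mdifferentiableAt (x := x)) (g.mdifferentiableAt (x := x))
  exact congrArg (fun L => L (X x)) this

theorem act_mul (X : VF V M) (f g : Fn V M) : act X (f * g) = f * act X g + g * act X f := by
  ext x
  have := mvfderiv_mul (f.mdifferentiableAt (x := x)) (g.mdifferentiableAt (x := x))
  exact congrArg (fun L => L (X x)) this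

theorem act_add (X Y : VF V M) (f : Fn V M) : act (X + Y) f = act X f + act Y f := by
  ext x
  exact map_add (d% f x) (X x) (Y x)

theorem act_smul (g : Fn V M) (X : VF V M) (f : Fn V M) : act (g • X) f = g * act X f := by
  ext x
  exact map_smul (d% f x) (g x) (X x)

theorem mdiff_VF (X : VF V M) (x : M) : MDiffAt (T% (X : Π y : M, TangentSpace 𝓘(ℝ, V) y)) x :=
  (X.contMDiff x).mdifferentiableAt (by simp)

theorem isManifold_two : IsManifold 𝓘(ℝ, V) (minSmoothness ℝ 2) M :=
  IsManifold.of_le (n := ∞) (by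
    rw [minSmoothness_of_isRCLikeNormedField]; exact WithTop.coe_le_coe.2 le_top)

/-- The Lie bracket `[X, Y]` of vector fields. -/
def bracket (X Y : VF V M) : VF V M :=
  ⟨VectorField.mlieBracket 𝓘(ℝ, V) X Y, by
    have h1 : IsManifold 𝓘(ℝ, V) (((⊤ : ℕ∞) : ℕ∞ω) + 1) M := by
      simpa using ‹IsManifold 𝓘(ℝ, V) ∞ M›
    have h2 := isManifold_two (V := V) (M := M)
    have : CompleteSpace V := FiniteDimensional.complete ℝ V
    exact ContDiff.mlieBracket_vectorField (m := ⊤) (n := ⊤) X.contMDiff Y.contMDiff (by simp)⟩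

theorem bracket_add (X Y Z : VF V M) : bracket X (Y + Z) = bracket X Y + bracket X Z := by
  ext x
  have := isManifold_two (V := V) (M := M)
  have : CompleteSpace V := FiniteDimensional.complete ℝ V
  exact VectorField.mlieBracket_add_right (mdiff_VF Y x) (mdiff_VF Z x)

theorem bracket_smul (X : VF V M) (f : Fn V M) (Y : VF V M) :
    bracket X (f • Y) = act X f • Y + f • bracket X Y := by
  ext x
  have := isManifold_two (V := V) (M := M)
  have : CompleteSpace V := FiniteDimensional.complete ℝ V
  exact VectorField.mlieBracket_smul_right (f.mdifferentiableAt (x := x)) (mdiff_VF Y x)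

variable (V M) in
/-- Differential 1-forms: a smooth 1-form is the same thing as a `C^∞(M)`-linear map
`χ(M) → C^∞(M)`, `X ↦ ⟨α, X⟩`. -/
abbrev Form1 : Type _ := VF V M →ₗ[Fn V M] Fn V M

variable (V M) in
/-- (1,1)-tensor fields: `C^∞(M)`-linear maps `J : χ(M) → χ(M)`. The transpose `ᵗJ` on 1-forms,
`⟨ᵗJ α, X⟩ = ⟨α, J X⟩`, is `α ↦ α ∘ₗ J`. -/
abbrev Tensor11 : Type _ := VF V M →ₗ[Fn V M] VF V M

variable (V M) in
/-- (2,0)-tensor fields, as `C^∞(M)`-linear maps `Λ : Ω¹(M) → χ(M)`. The associated bilinear form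
is `Λ(α, β) = ⟨β, Λ α⟩`. -/
abbrev Tensor20 : Type _ := Form1 V M →ₗ[Fn V M] VF V M

/-- `Λ` is a bivector field: `⟨α, Λ β⟩ + ⟨β, Λ α⟩ = 0`. -/
def IsBivector (L : Tensor20 V M) : Prop :=
  ∀ α β : Form1 V M, α (L β) + β (L α) = 0

/-- The differential `df` of a function, `⟨df, X⟩ = X(f)`. -/
def dFn (f : Fn V M) : Form1 V M where
  toFun X := act X f
  map_add' X Y := act_add X Y f
  map_smul' g X := act_smul g X f

/-- The Lie derivative `L_X β` of a 1-form, `⟨L_X β, Y⟩ = X⟨β, Y⟩ - ⟨β, [X, Y]⟩`. -/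
def lieDer (X : VF V M) (β : Form1 V M) : Form1 V M where
  toFun Y := act X (β Y) - β (bracket X Y)
  map_add' Y Z := by
    rw [map_add, act_add_fn, bracket_add, map_add]; ring
  map_smul' f Y := by
    simp only [map_smul, map_add, bracket_smul, smul_eq_mul, act_mul, RingHom.id_apply]; ring

/-- The Schouten-Nijenhuis bracket `[X, Λ]` of a vector field and a bivector field, i.e. the Lie
derivative of `Λ` along `X`, evaluated on a 1-form: `[X, Λ]α = [X, Λ α] - Λ(L_X α)`; equivalently
`[X, Λ](α, β) = X(Λ(α, β)) - Λ(L_X α, β) - Λ(α, L_X β)`. -/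
def schouten12 (X : VF V M) (L : Tensor20 V M) (α : Form1 V M) : VF V M :=
  bracket X (L α) - L (lieDer X α)

/-- The bracket `{f, g}_Λ = Λ(df, dg)` of functions. -/
def fnBracket (L : Tensor20 V M) (f g : Fn V M) : Fn V M := dFn g (L (dFn f))

/-- The Schouten-Nijenhuis bracket `[P, Q]` of two bivector fields, as a trivector field acting on
functions as a skew-symmetric triderivation, `[P, Q](df, dg, dh)`. It is the graded commutator
of multiderivations: the sum of `P(d(Q(df, dg)), dh) + Q(d(P(df, dg)), dh)` over cyclic
permutations of `f, g, h`. With this sign, `[E, Λ] = 0` and `[Λ, Λ] = 2 E ∧ Λ` hold if and only if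
the bracket `Λ(df, dg) + f E(g) - g E(f)` satisfies the Jacobi identity. -/
def schouten22 (P Q : Tensor20 V M) (f g h : Fn V M) : Fn V M :=
  (fnBracket P (fnBracket Q f g) h + fnBracket P (fnBracket Q g h) f
      + fnBracket P (fnBracket Q h f) g)
    + (fnBracket Q (fnBracket P f g) h + fnBracket Q (fnBracket P g h) f
      + fnBracket Q (fnBracket P h f) g)

/-- The trivector field `X ∧ Λ` on 1-forms:
`α(X) Λ(β, γ) + β(X) Λ(γ, α) + γ(X) Λ(α, β)`. -/
def wedge12 (X : VF V M) (L : Tensor20 V M) (α β γ : Form1 V M) : Fn V M :=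
  α X * γ (L β) + β X * α (L γ) + γ X * β (L α)

/-- `(Λ, E)` is a Jacobi structure: `Λ` is a bivector field, `[E, Λ] = 0` and
`[Λ, Λ] = 2 E ∧ Λ`. The second equation is an equality of trivector fields; these are determined
by their values on differentials of functions, which span every cotangent space. -/
structure IsJacobi (L : Tensor20 V M) (E : VF V M) : Prop where
  bivector : IsBivector L
  lie_eq_zero : ∀ α : Form1 V M, schouten12 E L α = 0
  schouten_eq : ∀ f g h : Fn V M,
    schouten22 L L f g h = 2 * wedge12 E L (dFn f) (dFn g) (dFn h)

/-- The Nijenhuis torsion `N_J(X, Y) = [JX, JY] - J[JX, Y] - J[X, JY] + J²[X, Y]`. -/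
def torsion (J : Tensor11 V M) (X Y : VF V M) : VF V M :=
  bracket (J X) (J Y) - J (bracket (J X) Y) - J (bracket X (J Y)) + J (J (bracket X Y))

/-- `J` is a Nijenhuis tensor: its Nijenhuis torsion vanishes. -/
def IsNijenhuis (J : Tensor11 V M) : Prop := ∀ X Y : VF V M, torsion J X Y = 0

/-- The bracket of 1-forms `{α, β}_Λ = L_{Λα} β - L_{Λβ} α - d(Λ(α, β))`. -/
def formBracket (L : Tensor20 V M) (α β : Form1 V M) : Form1 V M :=
  lieDer (L α) β - lieDer (L β) α - dFn (β (L α))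

/-- `C(Λ, J)(α, β) = {α, β}_{JΛ} - ({ᵗJα, β}_Λ + {α, ᵗJβ}_Λ - ᵗJ{α, β}_Λ)`. -/
def concomitant (L : Tensor20 V M) (J : Tensor11 V M) (α β : Form1 V M) : Form1 V M :=
  formBracket (J ∘ₗ L) α β
    - (formBracket L (α ∘ₗ J) β + formBracket L α (β ∘ₗ J) - (formBracket L α β) ∘ₗ J)

/-- `⟨ᵗJγ, Λ(C(Λ, J)(α, β)) - Λ(α, β) JE + Λ(α, ᵗJβ) E⟩ = 0` for all 1-forms `α, β, γ`. -/
def ConcomitantCondition (L : Tensor20 V M) (E : VF V M) (J : Tensor11 V M) : Prop :=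
  ∀ α β γ : Form1 V M,
    (γ ∘ₗ J) (L (concomitant L J α β) - β (L α) • J E + (β ∘ₗ J) (L α) • E) = 0

/-- `J` is compatible with the Jacobi structure `(Λ, E)`. -/
structure IsCompatible (L : Tensor20 V M) (E : VF V M) (J : Tensor11 V M) : Prop where
  torsion_bivector : ∀ α β : Form1 V M, torsion J (L α) (L β) = 0
  torsion_vector : ∀ (α : Form1 V M) (k : ℕ), torsion J (L α) ((J ^ k) E) = 0
  comm : ∀ α : Form1 V M, J (L α) = L (α ∘ₗ J)
  concomitant : ConcomitantCondition L E J
  lie : ∀ k : ℕ, 1 ≤ k → ∀ α : Form1 V M,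
    schouten12 ((J ^ k) E) L α + schouten12 E ((J ^ k) ∘ₗ L) α = 0

end JacobiNijenhuis

end

noncomputable section
namespace JacobiNijenhuis
variable {V : Type*} [NormedAddCommGroup V] [NormedSpace ℝ V] [FiniteDimensional ℝ V]
  {M : Type*} [TopologicalSpace M] [ChartedSpace V M] [IsManifold 𝓘(ℝ, V) ∞ M]

/-! The equation `[Λ, Λ] = 2 E ∧ Λ` is equivalent to the identity of vector fields `Λ{α, β}_Λ - [Λα,
Λβ] = α(E) Λβ - β(E) Λα + Λ(α, β) E` for all 1-forms (`isJacobi_iff`): on differentials the left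
side is half the Schouten bracket, both sides are tensorial, and differentials span the 1-forms
locally.

In this form the passage to `(JΛ, JE)` is algebra. Vanishing torsion expands `[JΛα, JΛβ]` into
brackets with at most one `J` inside, so the left side for `JΛ` becomes `JΛC(Λ, J)(α, β)` plus left
sides for `Λ` (`defect_comp`). Substituting the identity for `(Λ, E)` leaves exactly `J` of the
vector field in condition (b) (`defect_comp_sub`). In the same way `[JE, JΛ] = J([JE, Λ] + [E, JΛ])`
(`schouten12_comp`), which is condition (a). -/

theorem bracket_swap (X Y : VF V M) : bracket X Y = -bracket Y X := by
  ext x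
  exact VectorField.mlieBracket_swap_apply

-- In a chart this is the symmetry of the second derivative of `f`; the work is in transporting it
-- to `M`.
open VectorField in
theorem act_bracket (X Y : VF V M) (f : Fn V M) :
    act (bracket X Y) f = act X (act Y f) - act Y (act X f) := by
  ext x
  have h2 := isManifold_two (V := V) (M := M)
  have h2' : IsManifold 𝓘(ℝ, V) 2 M := IsManifold.of_le (n := ∞) (WithTop.coe_le_coe.2 le_top)
  have : CompleteSpace V := FiniteDimensional.complete ℝ V
  set φ := extChartAt 𝓘(ℝ, V) x with hφ
  have hx : x ∈ φ.source := mem_extChartAt_source x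
  have hφx : φ x ∈ φ.target := mem_extChartAt_target x
  -- The coordinate expression of a vector field in the chart at `x`.
  let P : VF V M → V → V := fun Z =>
    mpullbackWithin 𝓘(ℝ, V) 𝓘(ℝ, V) φ.symm (Z : Π y : M, TangentSpace 𝓘(ℝ, V) y)
      (Set.range 𝓘(ℝ, V))
  have hP : ∀ Z : VF V M, DifferentiableAt ℝ (P Z) (φ x) := by
    intro Z
    have h := (mdiff_VF Z x).mdifferentiableWithinAt
      (s := Set.univ) |>.differentiableWithinAt_mpullbackWithin_vectorField
    rw [Set.preimage_univ, Set.univ_inter] at h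
    exact h.differentiableAt (by rw [ModelWithCorners.range_eq_univ]; exact Filter.univ_mem)
  have hsmooth : ∀ y ∈ φ.target, CMDiffAt ∞ φ.symm y := by
    intro y hy
    have h := contMDiffWithinAt_extChartAt_symm_range (I := 𝓘(ℝ, V)) (n := ∞) x hy
    rwa [ModelWithCorners.range_eq_univ, contMDiffWithinAt_univ] at h
  have hchain : ∀ (g : Fn V M) (Z : VF V M), ∀ y ∈ φ.target,
      fderiv ℝ (g ∘ φ.symm) y (P Z y) = act Z g (φ.symm y) := by
    intro g Z y hy
    have h1 := mfderiv_comp_apply (I := 𝓘(ℝ, V)) (I' := 𝓘(ℝ, V)) (I'' := 𝓘(ℝ, ℝ)) y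
      (g.mdifferentiableAt (x := φ.symm y)) ((hsmooth y hy).mdifferentiableAt (by simp)) (P Z y)
    rw [mfderiv_eq_fderiv] at h1
    have h3 := (isInvertible_mfderivWithin_extChartAt_symm (I := 𝓘(ℝ, V)) hy).self_apply_inverse
      (Z (φ.symm y))
    have h4 : mfderiv 𝓘(ℝ, V) 𝓘(ℝ, V) φ.symm y (P Z y) = Z (φ.symm y) := by
      rw [← mfderivWithin_univ, ← ModelWithCorners.range_eq_univ 𝓘(ℝ, V)]
      exact h3
    rw [h4] at h1
    exact h1
  -- Equality near `φ x`, not only at the point, because these functions are differentiated once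
  -- more.
  have hev : ∀ (g : Fn V M) (Z : VF V M),
      (fun y => fderiv ℝ (g ∘ φ.symm) y (P Z y)) =ᶠ[nhds (φ x)] (act Z g) ∘ φ.symm := by
    intro g Z
    filter_upwards [extChartAt_target_mem_nhds (I := 𝓘(ℝ, V)) x] with y hy
    exact hchain g Z y hy
  have hf : ContDiffAt ℝ ∞ (f ∘ φ.symm) (φ x) :=
    (f.contMDiff.contMDiffAt.comp _ (hsmooth _ hφx)).contDiffAt
  have key := fderiv_apply_lieBracket (hf.of_le (m := 2) (WithTop.coe_le_coe.2 le_top)) (by simp)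
    (hP Y) (hP X)
  rw [(hev f Y).fderiv_eq, (hev f X).fderiv_eq, hchain _ _ _ hφx, hchain _ _ _ hφx] at key
  have hl : fderiv ℝ (f ∘ φ.symm) (φ x) (lieBracket ℝ (P X) (P Y) (φ x)) =
      act (bracket X Y) f x := by
    have h5 : bracket X Y x = (mfderiv 𝓘(ℝ, V) 𝓘(ℝ, V) φ x).inverse
        (lieBracket ℝ (P X) (P Y) (φ x) : V) := by
      rw [← lieBracketWithin_univ, ← ModelWithCorners.range_eq_univ 𝓘(ℝ, V)]
      change mlieBracketWithin 𝓘(ℝ, V) X Y Set.univ x = _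
      rw [mlieBracketWithin_apply, Set.preimage_univ, Set.univ_inter]
    have h6 := (isInvertible_mfderiv_extChartAt (I := 𝓘(ℝ, V)) hx).self_apply_inverse
      (lieBracket ℝ (P X) (P Y) (φ x) : V)
    rw [← h5] at h6
    have h7 : f =ᶠ[nhds x] (f ∘ φ.symm) ∘ φ := by
      filter_upwards [extChartAt_source_mem_nhds (I := 𝓘(ℝ, V)) x] with y hy
      exact congrArg f (φ.left_inv hy).symm
    have h8 := mfderiv_comp_apply (I := 𝓘(ℝ, V)) (I' := 𝓘(ℝ, V)) (I'' := 𝓘(ℝ, ℝ)) x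
      (hf.contMDiffAt.mdifferentiableAt (by simp))
      ((contMDiffAt_extChartAt (I := 𝓘(ℝ, V)) (n := ∞) (x := x)).mdifferentiableAt (by simp))
      (bracket X Y x)
    rw [← h7.mfderiv_eq, h6, mfderiv_eq_fderiv] at h8
    exact h8.symm
  rw [hl, φ.left_inv hx] at key
  exact key

/-- Near every point the vector fields are spanned by a frame dual to differentials. -/
theorem exists_smul_eq_sum_act [T2Space M] (x : M) :
    ∃ (χ : Fn V M) (n : ℕ) (f : Fin n → Fn V M) (e : Fin n → VF V M), χ x = 1 ∧
      ∀ X : VF V M, χ • X = ∑ i, act X (f i) • e i := by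
  have h2 : IsManifold 𝓘(ℝ, V) 1 M := IsManifold.of_le (n := ∞) (WithTop.coe_le_coe.2 le_top)
  -- Two nested cutoffs: `ψ = 1` near the support of `χ`. Then `ψ` times a coordinate is a global
  -- function with the differential of that coordinate wherever `χ ≠ 0`, and `χ` times the
  -- coordinate frame is a global vector field.
  obtain ⟨ψ⟩ : Nonempty (SmoothBumpFunction 𝓘(ℝ, V) x) := inferInstance
  obtain ⟨χ, hχ, -⟩ := (SmoothBumpFunction.nhds_basis_support (I := 𝓘(ℝ, V))
    (interior_mem_nhds.2 ψ.eventuallyEq_one)).mem_iff.1 Filter.univ_mem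
  let b := Module.finBasis ℝ V
  let φ := extChartAt 𝓘(ℝ, V) x
  let t := trivializationAt V (TangentSpace 𝓘(ℝ, V) : M → Type _) x
  have hψ : ∀ y ∈ tsupport χ, ψ =ᶠ[nhds y] 1 := fun y hy => mem_interior_iff_mem_nhds.1 (hχ hy)
  have hsrc : ∀ y ∈ tsupport χ, y ∈ (chartAt V x).source := fun y _ =>
    χ.tsupport_subset_chartAt_source ‹_›
  have hcoord : ∀ i, CMDiff[(chartAt V x).source] ∞ fun y => b.coord i (φ y) := fun i =>
    ((b.coord i).toContinuousLinearMap.contDiff.contMDiff).comp_contMDiffOn contMDiffOn_extChartAt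
  refine ⟨⟨χ, χ.contMDiff⟩, _, fun i => ⟨fun y => ψ y • b.coord i (φ y),
    ψ.contMDiff_smul (hcoord i)⟩, fun i => ⟨fun y => χ y • t.localFrame b i y, ?_⟩, χ.eq_one,
    fun X => ?_⟩
  · refine ContMDiffOn.smul_section_of_tsupport (u := t.baseSet) χ.contMDiff.contMDiffOn
      t.open_baseSet hsrc ?_
    exact t.contMDiffOn_localFrame_baseSet ∞ b i
  · ext y
    have hsum : ∀ e : Fin (Module.finrank ℝ V) → VF V M, (∑ i, e i) y = ∑ i, e i y := fun e =>
      map_sum (AddMonoidHom.mk' (fun Z : VF V M => Z y) fun _ _ => rfl) e Finset.univ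
    rw [hsum]
    simp only [smul_apply]
    change χ y • X y = ∑ i, _ • χ y • t.localFrame b i y
    by_cases hy : χ y = 0
    · simp only [hy, zero_smul, smul_zero, Finset.sum_const_zero]
    · replace hy : y ∈ tsupport χ := subset_tsupport _ hy
      have hyt : y ∈ t.baseSet := hsrc y hy
      have hX : X y = ∑ i, b.repr (t.continuousLinearMapAt ℝ y (X y)) i • t.localFrame b i y := by
        conv_lhs => rw [← (t.basisAt b hyt).sum_repr (X y)]
        refine Finset.sum_congr rfl fun i _ => ?_
        rw [t.localFrame_apply_of_mem_baseSet b hyt]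
        have h : t.continuousLinearMapAt ℝ y (X y) = t.linearEquivAt ℝ y hyt (X y) :=
          congrArg (fun l => l (X y)) (t.linearMapAt_def_of_mem (R := ℝ) hyt)
        rw [h]
        rfl
      conv_lhs => rw [hX, Finset.smul_sum]
      refine Finset.sum_congr rfl fun i _ => ?_
      rw [smul_comm]
      congr 1
      rw [TangentBundle.continuousLinearMapAt_trivializationAt (hsrc y hy)]
      have h7 : (fun z => ψ z • b.coord i (φ z)) =ᶠ[nhds y]
          (b.coord i).toContinuousLinearMap ∘ φ := by
        filter_upwards [hψ y hy] with z hz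
        simp [hz]
      have h8 := mfderiv_comp_apply (I := 𝓘(ℝ, V)) (I' := 𝓘(ℝ, V)) (I'' := 𝓘(ℝ, ℝ)) y
        (b.coord i).toContinuousLinearMap.mdifferentiableAt
        (mdifferentiableAt_extChartAt (I := 𝓘(ℝ, V)) (hsrc y hy)) (X y)
      rw [← h7.mfderiv_eq, mfderiv_eq_fderiv, ContinuousLinearMap.fderiv] at h8
      exact h8.symm

/-! ### Calculus of vector fields and 1-forms -/

theorem bracket_add_left (X Y Z : VF V M) : bracket (X + Y) Z = bracket X Z + bracket Y Z := by
  rw [bracket_swap, bracket_add, bracket_swap X, bracket_swap Y]; abel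

theorem bracket_smul_left (f : Fn V M) (X Y : VF V M) :
    bracket (f • X) Y = f • bracket X Y - act Y f • X := by
  rw [bracket_swap, bracket_smul, bracket_swap X, smul_neg]; abel

theorem act_neg_fn (X : VF V M) (f : Fn V M) : act X (-f) = -act X f :=
  (AddMonoidHom.mk' (act X) (act_add_fn X)).map_neg f

theorem dFn_neg (f : Fn V M) : dFn (-f) = -dFn f :=
  LinearMap.ext fun X => act_neg_fn X f

theorem dFn_mul (f g : Fn V M) : dFn (f * g) = f • dFn g + g • dFn f :=
  LinearMap.ext fun X => act_mul X f g

theorem lieDer_dFn (X : VF V M) (f : Fn V M) : lieDer X (dFn f) = dFn (act X f) :=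
  LinearMap.ext fun Y => by
    change act X (act Y f) - act (bracket X Y) f = act Y (act X f)
    rw [act_bracket]; ring

theorem lieDer_add (X : VF V M) (α β : Form1 V M) :
    lieDer X (α + β) = lieDer X α + lieDer X β :=
  LinearMap.ext fun Y => by
    change act X (α Y + β Y) - (α _ + β _) = act X (α Y) - α _ + (act X (β Y) - β _)
    rw [act_add_fn]; ring

theorem lieDer_add_left (X Y : VF V M) (α : Form1 V M) :
    lieDer (X + Y) α = lieDer X α + lieDer Y α :=
  LinearMap.ext fun Z => by
    change act (X + Y) (α Z) - α (bracket (X + Y) Z)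
      = act X (α Z) - α (bracket X Z) + (act Y (α Z) - α (bracket Y Z))
    rw [act_add, bracket_add_left, map_add]; ring

theorem lieDer_smul (X : VF V M) (f : Fn V M) (α : Form1 V M) :
    lieDer X (f • α) = act X f • α + f • lieDer X α :=
  LinearMap.ext fun Y => by
    change act X (f * α Y) - f * α (bracket X Y)
      = act X f * α Y + f * (act X (α Y) - α (bracket X Y))
    rw [act_mul]; ring

theorem lieDer_smul_left (f : Fn V M) (X : VF V M) (α : Form1 V M) :
    lieDer (f • X) α = f • lieDer X α + α X • dFn f :=
  LinearMap.ext fun Y => by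
    change act (f • X) (α Y) - α (bracket (f • X) Y)
      = f * (act X (α Y) - α (bracket X Y)) + α X * act Y f
    rw [act_smul, bracket_smul_left, map_sub, map_smul, map_smul]
    simp only [smul_eq_mul]; ring

theorem dFn_add (f g : Fn V M) : dFn (f + g) = dFn f + dFn g :=
  LinearMap.ext fun X => act_add_fn X f g

theorem formBracket_add (L : Tensor20 V M) (α β γ : Form1 V M) :
    formBracket L α (β + γ) = formBracket L α β + formBracket L α γ := by
  simp only [formBracket, lieDer_add, lieDer_add_left, LinearMap.add_apply, dFn_add, map_add]
  abel

theorem IsBivector.swap {L : Tensor20 V M} (hL : IsBivector L) (α β : Form1 V M) :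
    α (L β) = -β (L α) :=
  eq_neg_of_add_eq_zero_left (hL α β)

theorem IsBivector.formBracket_swap {L : Tensor20 V M} (hL : IsBivector L) (α β : Form1 V M) :
    formBracket L α β = -formBracket L β α := by
  simp only [formBracket, hL.swap α β, dFn_neg]
  abel

/-- The two multiples of `df`, from `L_{fΛβ} α` and from `d(f Λ(α, β))`, cancel by skewness. This
Leibniz rule matches that of the Lie bracket, which makes `defect` tensorial. -/
theorem IsBivector.formBracket_smul {L : Tensor20 V M} (hL : IsBivector L) (α β : Form1 V M)
    (f : Fn V M) :
    formBracket L α (f • β) = f • formBracket L α β + act (L α) f • β := by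
  simp only [formBracket, lieDer_smul, map_smul, lieDer_smul_left, LinearMap.smul_apply,
    smul_eq_mul, dFn_mul, hL.swap α β]
  module

theorem IsBivector.formBracket_dFn {L : Tensor20 V M} (hL : IsBivector L) (f g : Fn V M) :
    formBracket L (dFn f) (dFn g) = dFn (fnBracket L f g) := by
  rw [formBracket, lieDer_dFn, lieDer_dFn]
  change dFn (dFn g (L (dFn f))) - dFn (dFn f (L (dFn g))) - dFn (dFn g (L (dFn f))) = _
  rw [hL.swap (dFn f), dFn_neg, fnBracket]
  abel

/-! ### Determination by differentials of functions -/

/-- Near every point the 1-forms are spanned by differentials of functions. -/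
theorem exists_smul_eq_sum_dFn [T2Space M] (x : M) :
    ∃ (χ : Fn V M) (n : ℕ) (f : Fin n → Fn V M) (e : Fin n → VF V M), χ x = 1 ∧
      ∀ α : Form1 V M, χ • α = ∑ i, α (e i) • dFn (f i) := by
  obtain ⟨χ, n, f, e, hχ, h⟩ := exists_smul_eq_sum_act (V := V) x
  refine ⟨χ, n, f, e, hχ, fun α => LinearMap.ext fun X => ?_⟩
  rw [LinearMap.smul_apply, ← map_smul, h, map_sum, LinearMap.sum_apply]
  exact Finset.sum_congr rfl fun i _ => (map_smul α _ _).trans (mul_comm _ _)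

/-- By `C^∞(M)`-linearity, `T α` at `x` may be computed after multiplying `α` by a function equal to
1 at `x`. -/
theorem eq_zero_of_dFn [T2Space M] (T : Tensor20 V M) (hT : ∀ f, T (dFn f) = 0) (α : Form1 V M) :
    T α = 0 := by
  ext x
  obtain ⟨χ, n, f, e, hχ, h⟩ := exists_smul_eq_sum_dFn (V := V) x
  have h1 : χ • T α = 0 := by
    rw [← map_smul, h, map_sum]
    exact Finset.sum_eq_zero fun i _ => by rw [map_smul, hT, smul_zero]
  have h2 : χ x • T α x = 0 := congrArg (fun X : VF V M => X x) h1
  rwa [hχ, one_smul] at h2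

theorem VF_eq_zero_of_act [T2Space M] (X : VF V M) (hX : ∀ f, act X f = 0) : X = 0 := by
  ext x
  obtain ⟨χ, n, f, e, hχ, h⟩ := exists_smul_eq_sum_act (V := V) x
  have h1 : χ • X = 0 := by
    rw [h]
    exact Finset.sum_eq_zero fun i _ => by rw [hX, zero_smul]
  have h2 : χ x • X x = 0 := congrArg (fun Y : VF V M => Y x) h1
  rwa [hχ, one_smul] at h2

/-! ### The defect of a bivector field -/

/-- `Λ{α, β}_Λ - [Λα, Λβ]`. -/
def defect (L : Tensor20 V M) (α β : Form1 V M) : VF V M :=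
  L (formBracket L α β) - bracket (L α) (L β)

/-- `E ∧ Λ` contracted with two 1-forms. -/
def wedgeField (L : Tensor20 V M) (E : VF V M) (α β : Form1 V M) : VF V M :=
  α E • L β - β E • L α + β (L α) • E

variable {L : Tensor20 V M} {E : VF V M}

theorem IsBivector.apply_wedgeField (hL : IsBivector L) (α β γ : Form1 V M) :
    γ (wedgeField L E α β) = wedge12 E L α β γ := by
  simp only [wedgeField, wedge12, map_add, map_sub, map_smul, smul_eq_mul, hL.swap α γ]
  ring

/-- Evaluated on `dh`, the defect is the Jacobiator of `fnBracket L`; the factor 2 appears because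
the two cyclic sums in `schouten22` coincide for `P = Q`. -/
theorem IsBivector.apply_defect_dFn (hL : IsBivector L) (f g h : Fn V M) :
    2 * dFn h (defect L (dFn f) (dFn g)) = schouten22 L L f g h := by
  have swap : ∀ u v, fnBracket L u v = -fnBracket L v u := fun u v => hL.swap _ _
  have neg : ∀ u v, fnBracket L u (-v) = -fnBracket L u v := fun u v => act_neg_fn _ v
  have h1 : dFn h (defect L (dFn f) (dFn g)) = fnBracket L (fnBracket L f g) h
      - (fnBracket L f (fnBracket L g h) - fnBracket L g (fnBracket L f h)) := by
    rw [defect, hL.formBracket_dFn, map_sub]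
    exact congrArg _ (act_bracket (L (dFn f)) (L (dFn g)) h)
  rw [h1, swap f (fnBracket L g h), swap f h, neg, swap g (fnBracket L h f), schouten22]
  ring

/-- The difference of the two sides of the structure equation, as a tensor field in `β`. -/
def IsBivector.jacobiTensor (hL : IsBivector L) (E : VF V M) (α : Form1 V M) : Tensor20 V M where
  toFun β := defect L α β - wedgeField L E α β
  map_add' β γ := by
    simp only [defect, wedgeField, formBracket_add, map_add, bracket_add, LinearMap.add_apply]
    module
  map_smul' f β := by
    simp only [defect, wedgeField, hL.formBracket_smul, map_add, map_smul, bracket_smul,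
      LinearMap.smul_apply, smul_eq_mul, RingHom.id_apply]
    module

theorem IsBivector.jacobiTensor_swap (hL : IsBivector L) (E : VF V M) (α β : Form1 V M) :
    hL.jacobiTensor E α β = -hL.jacobiTensor E β α := by
  change defect L α β - wedgeField L E α β = -(defect L β α - wedgeField L E β α)
  simp only [defect, wedgeField, hL.formBracket_swap α β, bracket_swap (L α), hL.swap β α, map_neg]
  module

theorem isJacobi_iff [T2Space M] : IsJacobi L E ↔ IsBivector L ∧ (∀ α, schouten12 E L α = 0) ∧
    ∀ α β, defect L α β = wedgeField L E α β := by
  constructor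
  · intro h
    have hL := h.bivector
    refine ⟨hL, h.lie_eq_zero, fun α β => sub_eq_zero.1 ?_⟩
    have h1 : ∀ f g, hL.jacobiTensor E (dFn f) (dFn g) = 0 := by
      refine fun f g => VF_eq_zero_of_act _ fun k => ?_
      change dFn k (defect L (dFn f) (dFn g) - wedgeField L E (dFn f) (dFn g)) = 0
      have h2 := (hL.apply_defect_dFn f g k).trans (h.schouten_eq f g k)
      rw [map_sub, hL.apply_wedgeField]
      have h3 : (2 : Fn V M) * (dFn k (defect L (dFn f) (dFn g))
          - wedge12 E L (dFn f) (dFn g) (dFn k)) = 0 := by rw [mul_sub, h2, sub_self]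
      -- The factor 2 is cancelled pointwise, in `ℝ`.
      ext x
      rw [two_mul] at h3
      exact self_eq_neg.1 (eq_neg_of_add_eq_zero_left (congrArg (fun u : Fn V M => u x) h3))
    -- `jacobiTensor` is bundled as linear in its last slot only; skewness moves the general form
    -- from one slot to the other.
    have h2 : ∀ f β, hL.jacobiTensor E β (dFn f) = 0 := fun f β => by
      rw [hL.jacobiTensor_swap, eq_zero_of_dFn _ (h1 f), neg_zero]
    exact eq_zero_of_dFn (hL.jacobiTensor E α) (fun f => h2 f α) β
  · rintro ⟨hL, h1, h2⟩
    refine ⟨hL, h1, fun f g k => ?_⟩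
    rw [← hL.apply_defect_dFn, h2, hL.apply_wedgeField]

/-! ### Deformation by a (1,1)-tensor field -/

variable {J : Tensor11 V M}

theorem torsion_swap (X Y : VF V M) : torsion J X Y = -torsion J Y X := by
  simp only [torsion, bracket_swap (J X), bracket_swap X, map_neg]
  abel

theorem IsBivector.comp (hL : IsBivector L) (hJ : ∀ α, J (L α) = L (α ∘ₗ J)) :
    IsBivector (J ∘ₗ L) := fun α β => by
  have := hL (α ∘ₗ J) β
  rw [← hJ] at this
  exact this

/-- Expand `[JE, JΛα]` by the vanishing torsion and replace `[E, Λα]` by `Λ L_E α`. -/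
theorem schouten12_comp (hE : ∀ α, schouten12 E L α = 0)
    (hN : ∀ α, torsion J (L α) E = 0) (α : Form1 V M) :
    schouten12 (J E) (J ∘ₗ L) α
      = J (schouten12 (J E) L α + schouten12 E (J ∘ₗ L) α) := by
  have h1 : torsion J E (L α) = 0 := by rw [torsion_swap, hN, neg_zero]
  have h2 : bracket E (L α) = L (lieDer E α) := sub_eq_zero.1 (hE α)
  have h3 : bracket (J E) (J (L α))
      = J (bracket (J E) (L α)) + J (bracket E (J (L α))) - J (J (bracket E (L α))) := by
    rw [← sub_eq_zero, ← h1, torsion]; abel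
  simp only [schouten12, LinearMap.comp_apply, map_add, map_sub, h3, h2]
  abel

theorem defect_comp (hJ : ∀ α, J (L α) = L (α ∘ₗ J))
    (hN : ∀ α β, torsion J (L α) (L β) = 0) (α β : Form1 V M) :
    defect (J ∘ₗ L) α β = J (L (concomitant L J α β)) + J (defect L (α ∘ₗ J) β)
      + J (defect L α (β ∘ₗ J)) - J (J (defect L α β)) := by
  have h1 := hN α β
  have h3 : bracket (J (L α)) (J (L β))
      = J (bracket (J (L α)) (L β)) + J (bracket (L α) (J (L β)))
        - J (J (bracket (L α) (L β))) := by
    rw [← sub_eq_zero, ← h1, torsion]; abel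
  simp only [defect, concomitant, LinearMap.comp_apply, map_add, map_sub, h3, ← hJ]
  abel

theorem defect_comp_sub (hJ : ∀ α, J (L α) = L (α ∘ₗ J))
    (hN : ∀ α β, torsion J (L α) (L β) = 0) (hd : ∀ α β, defect L α β = wedgeField L E α β)
    (α β : Form1 V M) :
    defect (J ∘ₗ L) α β - wedgeField (J ∘ₗ L) (J E) α β =
      J (L (concomitant L J α β) - β (L α) • J E + (β ∘ₗ J) (L α) • E) := by
  have h : β (L (α ∘ₗ J)) = β (J (L α)) := by rw [hJ]
  rw [defect_comp hJ hN, hd, hd, hd]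
  simp only [wedgeField, LinearMap.comp_apply, map_add, map_sub, map_smul, ← hJ]
  module

theorem isJacobi_comp_iff [T2Space M] (hΛ : IsJacobi L E) (hJ : ∀ α, J (L α) = L (α ∘ₗ J))
    (hN : ∀ α β, torsion J (L α) (L β) = 0) (hNE : ∀ α, torsion J (L α) E = 0) :
    IsJacobi (J ∘ₗ L) (J E) ↔
      (∀ α, J (schouten12 (J E) L α + schouten12 E (J ∘ₗ L) α) = 0) ∧
        ConcomitantCondition L E J := by
  obtain ⟨hL, hE, hd⟩ := isJacobi_iff.1 hΛ
  rw [isJacobi_iff, and_iff_right (hL.comp hJ)]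
  refine and_congr (forall_congr' fun α => by rw [schouten12_comp hE hNE])
    (forall₂_congr fun α β => ?_)
  rw [← sub_eq_zero, defect_comp_sub hJ hN hd]
  -- Pairing with `ᵗJγ` is pairing `γ` with the image under `J`, and the forms `γ = df` already
  -- detect a vector field.
  exact ⟨fun h γ => by rw [LinearMap.comp_apply, h, map_zero], fun h => VF_eq_zero_of_act _ fun f => h (dFn f)⟩

end JacobiNijenhuis
end
theorem mainTheorem2 {V : Type*} [NormedAddCommGroup V] [NormedSpace ℝ V] [FiniteDimensional ℝ V]
    {M : Type*} [TopologicalSpace M] [T2Space M] [ChartedSpace V M] [IsManifold 𝓘(ℝ, V) ∞ M]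
    (Λ : JacobiNijenhuis.Tensor20 V M) (E : JacobiNijenhuis.VF V M)
    (J : JacobiNijenhuis.Tensor11 V M) (hΛ : JacobiNijenhuis.IsJacobi Λ E) :
    ((∀ α : JacobiNijenhuis.Form1 V M, J (Λ α) = Λ (α ∘ₗ J)) →
      (∀ α β : JacobiNijenhuis.Form1 V M, JacobiNijenhuis.torsion J (Λ α) (Λ β) = 0) →
      (∀ α : JacobiNijenhuis.Form1 V M, JacobiNijenhuis.torsion J (Λ α) E = 0) →
      (JacobiNijenhuis.IsJacobi (J ∘ₗ Λ) (J E) ↔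
        (∀ α : JacobiNijenhuis.Form1 V M,
          J (JacobiNijenhuis.schouten12 (J E) Λ α
            + JacobiNijenhuis.schouten12 E (J ∘ₗ Λ) α) = 0) ∧
        JacobiNijenhuis.ConcomitantCondition Λ E J)) ∧
    (JacobiNijenhuis.IsNijenhuis J → JacobiNijenhuis.IsCompatible Λ E J →
      JacobiNijenhuis.IsJacobi (J ∘ₗ Λ) (J E)) := by
  refine ⟨JacobiNijenhuis.isJacobi_comp_iff hΛ, fun _ h => ?_⟩
  -- Of the two families in the compatibility condition, only `k = 0` (where `J^0 E = E`) for the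
  -- torsion and `k = 1` for the Lie derivatives are needed.
  refine (JacobiNijenhuis.isJacobi_comp_iff hΛ h.comm h.torsion_bivector
    fun α => h.torsion_vector α 0).2 ⟨fun α => ?_, h.concomitant⟩
  have h1 := h.lie 1 le_rfl α
  rw [pow_one] at h1
  rw [h1, map_zero]
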